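/- Let $\mathcal H$ be a complex Hilbert space, $\mathcal K(\mathcal H)$ the $C^*$-algebra of compact operators on $\mathcal H$, and $\alpha$ a ($*$-)automorphism of $\mathcal K(\mathcal H)$. Then $\alpha$ is implemented by a unitary: there is a unitary $U$ on $\mathcal H$ with $\alpha(A)=UAU^*$ for all $A\in\mathcal K(\mathcal H)$. Moreover, let $U$ be any unitary implementing $\alpha$, let $\sigma_{\mathrm{pp}}(U)$ be the set of the eigenvalues $z\in\mathbb T$ of $U$, and for $z\in\sigma_{\mathrm{pp}}(U)$ let $E_z$ be the orthogonal projection onto the eigenspace $\ker(U-z)$. Let $\bigoplus_{z\in\sigma_{\mathrm{pp}}(U)}E_z\mathcal B(\mathcal H)E_z$ be the set of all bounded operators of the form $\sum_{z\in\sigma_{\mathrm{pp}}(U)}E_zC_zE_z$ with a norm-bounded family $(C_z)$ in $\mathcal B(\mathcal H)$, where the net of finite partial sums converges in the strong operator topology. Then: 1. For every $A\in\mathcal K(\mathcal H)$ the net of the finite partial sums of $\sum_{z\in\sigma_{\mathrm{pp}}(U)}E_zAE_z$ converges in the strong operator topology to a compact operator $E(A)$, and $A\mapsto E(A)$ is linear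 on $\mathcal K(\mathcal H)$. 2. The set $\mathfrak B=\big(\bigoplus_{z\in\sigma_{\mathrm{pp}}(U)}E_z\mathcal B(\mathcal H)E_z\big)\cap\mathcal K(\mathcal H)$ is a $C^*$-subalgebra of $\mathcal K(\mathcal H)$, and $E$ is a conditional expectation projecting onto it: $E(A)\in\mathfrak B$, $E(B)=B$, $\|E(A)\|\le\|A\|$, $E(A)\ge 0$ if $A\ge 0$, $E(BA)=B\,E(A)$ and $E(AB)=E(A)\,B$ for all $A\in\mathcal K(\mathcal H)$, $B\in\mathfrak B$. 3. The Cesàro means of $\alpha$ converge to $E$ pointwise in the weak topology of $\mathcal K(\mathcal H)$: for every $A\in\mathcal K(\mathcal H)$ and every bounded linear functional $\varphi$ on $\mathcal K(\mathcal H)$, $$\lim_{N\to\infty}\varphi\Big(\frac1N\sum_{n=0}^{N-1}\alpha^n(A)\Big)=\varphi(E(A)).$$ -/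

import Mathlib

open Filter Topology

section CompactOperators

variable {H : Type*} [NormedAddCommGroup H] [InnerProductSpace ℂ H] [CompleteSpace H]

/-- The adjoint of a compact operator on a Hilbert space is compact. -/
theorem isCompactOperator_star {T : H →L[ℂ] H} (hT : IsCompactOperator T) :
    IsCompactOperator (star T : H →L[ℂ] H) := by
  have hc : IsCompactOperator (T ∘L (star T : H →L[ℂ] H)) := hT.comp_clm (star T : H →L[ℂ] H)
  rw [← ContinuousLinearMap.coe_coe, isCompactOperator_iff_isCompact_closure_image_closedBall
    _ one_pos]
  refine (TotallyBounded.closure ?_).isCompact_of_isClosed isClosed_closure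
  have htb : TotallyBounded ((T ∘L (star T : H →L[ℂ] H)) '' Metric.closedBall 0 1) := by
    have h1 := (isCompactOperator_iff_isCompact_closure_image_closedBall
      ((T ∘L (star T : H →L[ℂ] H)) : H →ₗ[ℂ] H) one_pos).1 hc
    exact h1.totallyBounded.subset subset_closure
  rw [Metric.totallyBounded_iff]
  intro ε hε
  obtain ⟨t, htsub, htfin, htcov⟩ :=
    totallyBounded_iff_subset.1 htb _ (Metric.dist_mem_uniformity (ε := ε ^ 2 / 2) (by positivity))
  choose! g hg using fun y (hy : y ∈ t) => htsub hy
  refine ⟨(fun y => (star T : H →L[ℂ] H) (g y)) '' t, htfin.image _, ?_⟩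
  rintro _ ⟨x, hx, rfl⟩
  have hmem := htcov ⟨x, hx, rfl⟩
  simp only [Set.mem_iUnion, Set.mem_ofPred_eq, exists_prop] at hmem ⊢
  obtain ⟨y, hy, hxy⟩ := hmem
  refine ⟨_, ⟨y, hy, rfl⟩, ?_⟩
  obtain ⟨hgb, hgy⟩ := hg y hy
  simp only [Metric.mem_closedBall, dist_zero_right] at hx hgb
  have hdist : ‖T ((star T : H →L[ℂ] H) (x - g y))‖ < ε ^ 2 / 2 := by
    have : T ((star T : H →L[ℂ] H) (x - g y)) = (T ∘L (star T : H →L[ℂ] H)) x - y := by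
      conv_rhs => rw [← hgy]
      simp
    rw [this, ← dist_eq_norm]
    exact hxy
  have hn : ‖x - g y‖ ≤ 2 := (norm_sub_le _ _).trans (by linarith)
  have hsq : ‖(star T : H →L[ℂ] H) (x - g y)‖ ^ 2 < ε ^ 2 := by
    have h1 : ‖(star T : H →L[ℂ] H) (x - g y)‖ ^ 2
        = RCLike.re (inner ℂ (T ((star T : H →L[ℂ] H) (x - g y))) (x - g y)) := by
      rw [← ContinuousLinearMap.adjoint_inner_right, ← ContinuousLinearMap.star_eq_adjoint,
        inner_self_eq_norm_sq]
    rw [h1]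
    have h2 := (RCLike.re_le_norm _).trans
      (norm_inner_le_norm (𝕜 := ℂ) (T ((star T : H →L[ℂ] H) (x - g y))) (x - g y))
    nlinarith [norm_nonneg (T ((star T : H →L[ℂ] H) (x - g y))), norm_nonneg (x - g y)]
  have := lt_of_pow_lt_pow_left₀ 2 hε.le hsq
  rw [Metric.mem_ball, dist_eq_norm]
  simpa using this

variable (H) in
/-- `K(H)`, the C*-algebra of compact operators on the Hilbert space `H`, as a star subalgebra
of the algebra of bounded operators, with the operator norm. -/
def compactOperators : NonUnitalStarSubalgebra ℂ (H →L[ℂ] H) where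
  carrier := {T | IsCompactOperator T}
  add_mem' hS hT := IsCompactOperator.add hS hT
  zero_mem' := isCompactOperator_zero
  mul_mem' {_ T} hS _ := IsCompactOperator.comp_clm hS T
  smul_mem' c _ hT := IsCompactOperator.smul hT c
  star_mem' hT := isCompactOperator_star hT

/-- `σ_pp(U)`: the set of the eigenvalues of `U` on the unit circle. -/
def ppSpectrum (U : H →L[ℂ] H) : Set ℂ :=
  {z | ‖z‖ = 1 ∧ Module.End.HasEigenvalue (U : Module.End ℂ H) z}

/-- `E_z`: the selfadjoint projection of `H` onto the (closed) eigenspace `ker (U - z)`. -/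
noncomputable def eigenProj (U : H →L[ℂ] H) (z : ℂ) : H →L[ℂ] H :=
  haveI : CompleteSpace (Module.End.eigenspace (U : Module.End ℂ H) z) :=
    (ContinuousLinearMap.isClosed_eigenspace (f := U) (μ := z)).completeSpace_coe
  (Module.End.eigenspace (U : Module.End ℂ H) z).starProjection

/-- `⨁_{z ∈ σ_pp(U)} E_z B(H) E_z`: the bounded operators `B = ∑_z E_z C_z E_z`, where `(C_z)` is a
norm-bounded family in `B(H)` and the net of finite partial sums converges in the strong operator
topology. -/
def eigenBlockSum (U : H →L[ℂ] H) : Set (H →L[ℂ] H) :=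
  {B | ∃ C : ppSpectrum U → (H →L[ℂ] H), (∃ M : ℝ, ∀ z, ‖C z‖ ≤ M) ∧
    ∀ x : H, HasSum (fun z : ppSpectrum U => eigenProj U z (C z (eigenProj U z x))) (B x)}

/-- `U` implements the automorphism `α` of `K(H)`: `α = Ad_U`, i.e. `α(A) = U A U*`. -/
def Implements (U : unitary (H →L[ℂ] H)) (α : compactOperators H ≃⋆ₐ[ℂ] compactOperators H) :
    Prop :=
  ∀ A : compactOperators H,
    (α A : H →L[ℂ] H) = (U : H →L[ℂ] H) * (A : H →L[ℂ] H) * star (U : H →L[ℂ] H)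

/-- The linear map `E : K(H) → K(H)` is a conditional expectation projecting onto the
C*-subalgebra `𝔅` of `K(H)`: `𝔅` is norm closed, and `E` is a contractive positive
`𝔅`-bimodule projection with range `𝔅`. -/
structure IsConditionalExpectation (𝔅 : NonUnitalStarSubalgebra ℂ (compactOperators H))
    (E : compactOperators H →ₗ[ℂ] compactOperators H) : Prop where
  isClosed : IsClosed (𝔅 : Set (compactOperators H))
  map_mem : ∀ A, E A ∈ 𝔅
  map_of_mem : ∀ B ∈ 𝔅, E B = B
  norm_map_le : ∀ A, ‖E A‖ ≤ ‖A‖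
  map_isPositive : ∀ A : compactOperators H,
    (A : H →L[ℂ] H).IsPositive → (E A : H →L[ℂ] H).IsPositive
  map_mul_left : ∀ B ∈ 𝔅, ∀ A, E (B * A) = B * E A
  map_mul_right : ∀ B ∈ 𝔅, ∀ A, E (A * B) = E A * B

end CompactOperators

/-! The core is a mean ergodic argument on the Banach space K(H), where α is an isometry. By
Hahn–Banach, the Cesàro means converge in norm, hence weakly, once no nonzero α-invariant functional
vanishes on all fixed points (`exists_tendsto_birkhoffAverage`).

To verify this (`Implements.eq_zero_of_invariant`), represent φ by the operator T with ⟨T y, x⟩ =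
φ(|x⟩⟨y|). T is Hilbert–Schmidt, hence compact, and invariance of φ makes it commute with U. A
compact operator commuting with U kills the orthogonal complement of the eigenvectors of U
(`apply_eq_zero_of_commute`), so T = ∑ E_z T E_z strongly. Each |E_z x⟩⟨E_z y| is fixed by α, so
every block of T vanishes.

The same structure result identifies 𝔅 with the fixed points of α. The limit E(A) is fixed, hence
the sum of its diagonal blocks; these are the blocks of A because A ↦ E_z A E_z is α-invariant.

The unitary itself is rebuilt from rank one operators: α(|e⟩⟨e|) = |f⟩⟨f| for unit vectors e, f, and
Uξ = α(|ξ⟩⟨e|) f. -/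

open Function InnerProductSpace

/-! ### Mean ergodic theorem for linear contractions -/

section MeanErgodic

variable {X : Type*} [NormedAddCommGroup X] [NormedSpace ℂ X]

theorem dist_birkhoffAverage_id_le {f : X → X} (hf : LipschitzWith 1 f) (n : ℕ) (x y : X) :
    dist (birkhoffAverage ℂ f id n x) (birkhoffAverage ℂ f id n y) ≤ dist x y := by
  refine (dist_birkhoffAverage_birkhoffAverage_le ℂ f id n x y).trans ?_
  have h : ∑ k ∈ Finset.range n, dist (id (f^[k] x)) (id (f^[k] y)) ≤ n * dist x y := by
    refine (Finset.sum_le_card_nsmul _ _ (dist x y) fun k _ => ?_).trans (by simp)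
    simpa using (hf.iterate k).dist_le_mul x y
  rcases Nat.eq_zero_or_pos n with rfl | hn
  · simp
  · rw [div_le_iff₀ (by exact_mod_cast hn)]
    linarith

theorem norm_birkhoffAverage_id_le {f : X →ₗ[ℂ] X} (hf : LipschitzWith 1 f) (n : ℕ) (x : X) :
    ‖birkhoffAverage ℂ f id n x‖ ≤ ‖x‖ := by
  have h0 : birkhoffAverage ℂ f id n 0 = 0 := by
    simp [birkhoffAverage, birkhoffSum, iterate_map_zero]
  simpa [h0] using dist_birkhoffAverage_id_le hf n x 0

theorem birkhoffAverage_id_add (f : X →ₗ[ℂ] X) (n : ℕ) (x y : X) :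
    birkhoffAverage ℂ f id n (x + y) =
      birkhoffAverage ℂ f id n x + birkhoffAverage ℂ f id n y := by
  have H : ∀ n x y, f^[n] (x + y) = f^[n] x + f^[n] y := iterate_map_add (f : X →+ X)
  simp [birkhoffAverage, birkhoffSum, H, Finset.sum_add_distrib]

theorem birkhoffAverage_id_smul (f : X →ₗ[ℂ] X) (n : ℕ) (c : ℂ) (x : X) :
    birkhoffAverage ℂ f id n (c • x) = c • birkhoffAverage ℂ f id n x := by
  have H : ∀ n x, f^[n] (c • x) = c • f^[n] x := fun n x => by
    induction n with
    | zero => rfl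
    | succ k ih => rw [iterate_succ_apply', iterate_succ_apply', ih, map_smul]
  simp [birkhoffAverage, birkhoffSum, H, Finset.smul_sum, smul_comm c]

/-- The difference telescopes to (fⁿ x - x) / n, and the orbit of x is bounded by ‖x‖. -/
theorem tendsto_birkhoffAverage_id_sub {f : X →ₗ[ℂ] X} (hf : LipschitzWith 1 f) (x : X) :
    Tendsto (fun n => birkhoffAverage ℂ f id n (f x) - birkhoffAverage ℂ f id n x) atTop
      (𝓝 0) := by
  refine tendsto_birkhoffAverage_apply_sub_birkhoffAverage ℂ
    (isBounded_iff_forall_norm_le.2 ⟨‖x‖, Set.forall_mem_range.2 fun n => ?_⟩)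
  have H : f^[n] 0 = 0 := iterate_map_zero (f : X →+ X) n
  simpa [H] using (hf.iterate n).dist_le_mul x 0

/-- The subspace of the vectors whose Birkhoff averages form a Cauchy sequence. -/
def cauchyAverages (f : X →ₗ[ℂ] X) : Submodule ℂ X where
  carrier := {x | CauchySeq (birkhoffAverage ℂ f id · x)}
  add_mem' {x y} hx hy := by
    have := CauchySeq.add hx hy
    rw [Set.mem_ofPred_eq, funext fun n => birkhoffAverage_id_add f n x y]
    exact this
  zero_mem' := by
    have : ∀ n, birkhoffAverage ℂ f id n (0 : X) = 0 := fun n => by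
      simpa using birkhoffAverage_id_smul f n 0 0
    simpa only [Set.mem_ofPred_eq, this] using cauchySeq_const (0 : X)
  smul_mem' c x hx := by
    rw [Set.mem_ofPred_eq, funext fun n => birkhoffAverage_id_smul f n c x]
    exact (uniformContinuous_const_smul c).comp_cauchySeq hx

/-- The averages are 1-Lipschitz uniformly in n, so an ε/3 argument applies. -/
theorem isClosed_cauchyAverages {f : X →ₗ[ℂ] X} (hf : LipschitzWith 1 f) :
    IsClosed (cauchyAverages f : Set X) := by
  refine isClosed_of_closure_subset fun x hx => ?_
  change CauchySeq (birkhoffAverage ℂ f id · x)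
  rw [Metric.cauchySeq_iff]
  intro ε hε
  obtain ⟨y, hy, hxy⟩ := Metric.mem_closure_iff.1 hx (ε / 3) (by positivity)
  obtain ⟨N, hN⟩ := Metric.cauchySeq_iff.1 hy (ε / 3) (by positivity)
  refine ⟨N, fun m hm n hn => ?_⟩
  have h1 := dist_birkhoffAverage_id_le hf m x y
  have h2 := dist_birkhoffAverage_id_le hf n y x
  have h3 := hN m hm n hn
  have h4 := dist_triangle4 (birkhoffAverage ℂ f id m x) (birkhoffAverage ℂ f id m y)
    (birkhoffAverage ℂ f id n y) (birkhoffAverage ℂ f id n x)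
  rw [dist_comm y x] at h2
  linarith

/-- **Mean ergodic theorem** for a linear contraction `f` of a Banach space: if the only invariant
functional which vanishes on the fixed points is zero, then all Birkhoff averages converge in
norm. -/
theorem exists_tendsto_birkhoffAverage [CompleteSpace X] {f : X →ₗ[ℂ] X} (hf : LipschitzWith 1 f)
    (h : ∀ φ : StrongDual ℂ X, (∀ x, φ (f x) = φ x) → (∀ x, f x = x → φ x = 0) → φ = 0) :
    ∃ E : X →ₗ[ℂ] X, ∀ x, Tendsto (birkhoffAverage ℂ f id · x) atTop (𝓝 (E x)) := by
  have htop : ∀ x, x ∈ cauchyAverages f := by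
    by_contra! hcon
    obtain ⟨x, hx⟩ := hcon
    have hclosed : IsClosed ((cauchyAverages f : Submodule ℂ X) : Set X) :=
      isClosed_cauchyAverages hf
    have : IsClosed ((cauchyAverages f).toAddSubgroup : Set X) := hclosed
    -- Hahn–Banach in the quotient by the closed subspace `cauchyAverages f`. The pulled-back
    -- functional vanishes on fixed points and on all f y - y, so it is invariant and `h` forces it
    -- to be zero.
    obtain ⟨ψ, hψ⟩ := SeparatingDual.exists_ne_zero (R := ℂ)
      (x := (cauchyAverages f).mkQ x) (by simpa using hx)
    have hφ : ∀ y ∈ cauchyAverages f, (ψ.comp (cauchyAverages f).mkQL) y = 0 := fun y hy => by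
      have : (cauchyAverages f).mkQL y = 0 := by simpa using hy
      rw [ContinuousLinearMap.comp_apply, this, map_zero]
    have h0 := h (ψ.comp (cauchyAverages f).mkQL) (fun y => ?_) (fun y hy => hφ y ?_)
    · exact hψ (DFunLike.congr_fun h0 x)
    · rw [← sub_eq_zero, ← map_sub]
      refine hφ _ ?_
      refine ((tendsto_birkhoffAverage_id_sub hf y).congr fun n => ?_).cauchySeq
      have := birkhoffAverage_id_add f n (f y - y) y
      rw [sub_add_cancel] at this
      rw [this, add_sub_cancel_right]
    · exact (IsFixedPt.tendsto_birkhoffAverage ℂ (f := f) hy id).cauchySeq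
  choose E hE using fun x => cauchySeq_tendsto_of_complete (htop x)
  refine ⟨⟨⟨E, fun x y => ?_⟩, fun c x => ?_⟩, hE⟩
  · refine tendsto_nhds_unique (hE (x + y)) ?_
    simpa only [birkhoffAverage_id_add] using (hE x).add (hE y)
  · refine tendsto_nhds_unique (hE (c • x)) ?_
    simpa only [birkhoffAverage_id_smul, RingHom.id_apply] using (hE x).const_smul c

/-- The limit of the Birkhoff averages is a fixed point. -/
theorem map_eq_of_tendsto_birkhoffAverage {f : X →ₗ[ℂ] X} (hf : LipschitzWith 1 f) {x y : X}
    (hy : Tendsto (birkhoffAverage ℂ f id · x) atTop (𝓝 y)) : f y = y := by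
  have h1 := (hf.continuous.tendsto y).comp hy
  have h2 : ∀ n, f (birkhoffAverage ℂ f id n x) = birkhoffAverage ℂ f id n (f x) := fun n => by
    simp only [birkhoffAverage, birkhoffSum, id, map_smul, map_sum]
    simp only [← iterate_succ_apply', iterate_succ_apply]
  have h3 := (tendsto_birkhoffAverage_id_sub hf x).add hy
  simp only [sub_add_cancel, zero_add] at h3
  refine tendsto_nhds_unique h1 (h3.congr fun n => ?_)
  exact (h2 n).symm

end MeanErgodic

/-! ### Rank one operators and their density in K(H) -/

section RankOne

variable {H : Type*} [NormedAddCommGroup H] [InnerProductSpace ℂ H]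

theorem isCompactOperator_rankOne (x y : H) : IsCompactOperator (rankOne ℂ x y : H →L[ℂ] H) := by
  rw [rankOne_def']
  exact (isCompactOperator_of_locallyCompactSpace_rng
    (ContinuousLinearMap.toSpanSingleton ℂ x)).comp_clm (innerSL ℂ y)

variable [CompleteSpace H]

/-- The rank one operator `|x⟩⟨y|` as an element of `K(H)`. -/
noncomputable def rankOneCompact (x y : H) : compactOperators H :=
  ⟨rankOne ℂ x y, isCompactOperator_rankOne x y⟩

@[simp]
theorem coe_rankOneCompact (x y : H) :
    (rankOneCompact x y : H →L[ℂ] H) = rankOne ℂ x y := rfl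

theorem rankOneCompact_add_left (x x' y : H) :
    rankOneCompact (x + x') y = rankOneCompact x y + rankOneCompact x' y := by
  ext; simp [rankOneCompact]

theorem rankOneCompact_add_right (x y y' : H) :
    rankOneCompact x (y + y') = rankOneCompact x y + rankOneCompact x y' := by
  ext; simp [rankOneCompact]

theorem rankOneCompact_smul_left (c : ℂ) (x y : H) :
    rankOneCompact (c • x) y = c • rankOneCompact x y := by
  ext; simp [rankOneCompact]

theorem rankOneCompact_smul_right (c : ℂ) (x y : H) :
    rankOneCompact x (c • y) = star c • rankOneCompact x y := by
  ext; simp [rankOneCompact]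

theorem mul_rankOneCompact (A : compactOperators H) (x y : H) :
    A * rankOneCompact x y = rankOneCompact ((A : H →L[ℂ] H) x) y := by
  ext; simp [rankOneCompact]

theorem rankOneCompact_mul (A : compactOperators H) (x y : H) :
    rankOneCompact x y * A = rankOneCompact x (star (A : H →L[ℂ] H) y) := by
  ext
  simp [rankOneCompact, ContinuousLinearMap.star_eq_adjoint,
    ContinuousLinearMap.adjoint_inner_left]

theorem rankOneCompact_mul_rankOneCompact (x y z w : H) :
    rankOneCompact x y * rankOneCompact z w = inner ℂ y z • rankOneCompact x w := by
  rw [mul_rankOneCompact, ← rankOneCompact_smul_left]; simp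

theorem star_rankOneCompact (x y : H) : star (rankOneCompact x y) = rankOneCompact y x := by
  ext1
  simp [rankOneCompact, ContinuousLinearMap.star_eq_adjoint]

theorem norm_rankOneCompact (x y : H) : ‖rankOneCompact x y‖ = ‖x‖ * ‖y‖ :=
  norm_rankOne ..

/-- Compressions of a compact operator by suitable finite rank projections approximate it. -/
theorem exists_sum_rankOneCompact_near (A : compactOperators H) {ε : ℝ} (hε : 0 < ε) :
    ∃ (n : ℕ) (x y : Fin n → H), ‖A - ∑ i, rankOneCompact (x i) (y i)‖ ≤ ε := by
  have hc := A.2.isCompact_closure_image_closedBall (f := ((A : H →L[ℂ] H) : H →ₗ[ℂ] H)) 1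
  obtain ⟨t, htfin, htcov⟩ := Metric.totallyBounded_iff.1
    (hc.totallyBounded.subset subset_closure) ε hε
  -- V is spanned by a finite ε-net of the image of the unit ball. With P the projection onto V, the
  -- approximant is P A = ∑ |b i⟩⟨A* (b i)|.
  let V := Submodule.span ℂ t
  have : FiniteDimensional ℂ V := FiniteDimensional.span_of_finite ℂ htfin
  let b := stdOrthonormalBasis ℂ V
  refine ⟨_, fun i => (b i : H), fun i => star (A : H →L[ℂ] H) (b i), ?_⟩
  have hsum : ((∑ i, rankOneCompact (b i : H) (star (A : H →L[ℂ] H) (b i)) :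
      compactOperators H) : H →L[ℂ] H) = V.starProjection ∘L (A : H →L[ℂ] H) := by
    rw [b.starProjection_eq_sum_rankOne]
    ext x
    simp [ContinuousLinearMap.star_eq_adjoint, ContinuousLinearMap.adjoint_inner_left]
  change ‖((A - ∑ i, rankOneCompact (b i : H) (star (A : H →L[ℂ] H) (b i)) :
    compactOperators H) : H →L[ℂ] H)‖ ≤ ε
  rw [NonUnitalStarSubalgebra.coe_sub, hsum]
  refine ContinuousLinearMap.opNorm_le_of_unit_norm hε.le fun x hx => ?_
  have hmem := htcov ⟨x, by simp [hx], rfl⟩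
  simp only [Set.mem_iUnion, exists_prop] at hmem
  obtain ⟨y, hy, hxy⟩ := hmem
  rw [Metric.mem_ball, dist_eq_norm] at hxy
  have hyV : y ∈ V := Submodule.subset_span hy
  refine le_trans ?_ hxy.le
  change ‖(A : H →L[ℂ] H) x - V.starProjection ((A : H →L[ℂ] H) x)‖ ≤ _
  -- The projection realises the distance to V, which is at most the distance to the net point y.
  rw [Submodule.starProjection_minimal]
  exact ciInf_le ⟨0, by rintro _ ⟨z, rfl⟩; positivity⟩ (⟨y, hyV⟩ : V)

/-- A bounded functional on `K(H)` which vanishes on the rank one operators is zero. -/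
theorem eq_zero_of_forall_rankOneCompact (φ : StrongDual ℂ (compactOperators H))
    (h : ∀ x y, φ (rankOneCompact x y) = 0) : φ = 0 := by
  ext A
  rw [zero_apply, ← norm_le_zero_iff]
  refine le_of_forall_pos_le_add fun ε hε => ?_
  obtain ⟨n, x, y, hxy⟩ := exists_sum_rankOneCompact_near A
    (ε := ε / (‖φ‖ + 1)) (by positivity)
  have h1 : φ A = φ (A - ∑ i, rankOneCompact (x i) (y i)) := by simp [h]
  rw [h1, zero_add]
  refine (φ.le_opNorm_of_le hxy).trans ?_
  rw [mul_div_assoc', div_le_iff₀ (by positivity)]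
  nlinarith [norm_nonneg φ]

end RankOne

/-! ### Automorphisms of K(H) are unitarily implemented -/

section UnitaryImplementation

variable {H : Type*} [NormedAddCommGroup H] [InnerProductSpace ℂ H] [CompleteSpace H]

theorem map_star_compactOperators (α : compactOperators H ≃⋆ₐ[ℂ] compactOperators H)
    (A : compactOperators H) : α (star A) = star (α A) :=
  α.map_star' A

/-- A star automorphism of `K(H)` sends a rank one projection to a rank one projection. -/
theorem exists_map_rankOneCompact_self (α : compactOperators H ≃⋆ₐ[ℂ] compactOperators H)
    {e : H} (he : ‖e‖ = 1) :
    ∃ f : H, ‖f‖ = 1 ∧ α (rankOneCompact e e) = rankOneCompact f f := by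
  set p := rankOneCompact e e with hp
  have hee : inner ℂ e e = (1 : ℂ) := by simp [inner_self_eq_norm_sq_to_K, he]
  have hpp : p * p = p := by rw [hp, rankOneCompact_mul_rankOneCompact, hee, one_smul]
  have hp0 : p ≠ 0 := fun h => by
    have := norm_rankOneCompact e e
    rw [← hp, h] at this
    simp [he] at this
  have hq0 : (α p : H →L[ℂ] H) ≠ 0 := fun h => hp0 (by
    have : α p = 0 := Subtype.ext h
    simpa using this)
  obtain ⟨x, hx⟩ : ∃ x, (α p : H →L[ℂ] H) x ≠ 0 := by
    by_contra! hcon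
    exact hq0 (ContinuousLinearMap.ext hcon)
  set f₀ := (α p : H →L[ℂ] H) x
  set f : H := ((‖f₀‖⁻¹ : ℝ) : ℂ) • f₀
  have hf : ‖f‖ = 1 := by
    simp [f, norm_smul, inv_mul_cancel₀ (norm_ne_zero_iff.2 hx)]
  have hqf : (α p : H →L[ℂ] H) f = f := by
    have : (α p : H →L[ℂ] H) f₀ = f₀ := by
      have h2 : (α p : H →L[ℂ] H) * (α p : H →L[ℂ] H) = α p := by
        have := congr_arg (fun T => ((α T : compactOperators H) : H →L[ℂ] H)) hpp
        simpa using this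
      exact DFunLike.congr_fun h2 x
    rw [map_smul, this]
  have hqs : star (α p : H →L[ℂ] H) = α p := by
    have : star (α p) = α p := by rw [← map_star_compactOperators, hp, star_rankOneCompact]
    exact congr_arg Subtype.val this
  refine ⟨f, hf, ?_⟩
  -- compressions by a minimal projection are scalar
  obtain ⟨c, hc⟩ : ∃ c : ℂ, rankOneCompact f f = c • α p := by
    refine ⟨inner ℂ e ((α.symm (rankOneCompact f f) : H →L[ℂ] H) e), ?_⟩
    have h1 : rankOneCompact f f = α p * rankOneCompact f f * α p := by
      rw [mul_rankOneCompact, rankOneCompact_mul, hqs, hqf]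
    have h2 : p * α.symm (rankOneCompact f f) * p =
        inner ℂ e ((α.symm (rankOneCompact f f) : H →L[ℂ] H) e) • p := by
      rw [mul_assoc, hp, mul_rankOneCompact, rankOneCompact_mul_rankOneCompact]
    rw [← map_smul, ← h2, map_mul, map_mul, StarAlgEquiv.apply_symm_apply, ← h1]
  -- Both |f⟩⟨f| and α p fix f.
  have hc1 : c = 1 := by
    have h1 : (rankOneCompact f f : H →L[ℂ] H) f = c • (α p : H →L[ℂ] H) f := by
      rw [hc]; rfl
    rw [hqf, coe_rankOneCompact, rankOne_apply, inner_self_eq_norm_sq_to_K, hf] at h1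
    have h2 : ((1 : ℂ) - c) • f = 0 := by
      rw [sub_smul, ← h1]; simp
    rcases smul_eq_zero.1 h2 with h3 | h3
    · exact (sub_eq_zero.1 h3).symm
    · simp [h3] at hf
  rw [hc, hc1, one_smul]

/-- Every star automorphism of `K(H)` is implemented by a unitary operator. -/
theorem exists_implements (α : compactOperators H ≃⋆ₐ[ℂ] compactOperators H) :
    ∃ U : unitary (H →L[ℂ] H), Implements U α := by
  rcases subsingleton_or_nontrivial H with hH | hH
  · exact ⟨1, fun A => Subsingleton.elim _ _⟩
  obtain ⟨e, he⟩ := exists_norm_eq H (zero_le_one' ℝ)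
  obtain ⟨f, hf, hef⟩ := exists_map_rankOneCompact_self α he
  have hff : inner ℂ f f = (1 : ℂ) := by simp [inner_self_eq_norm_sq_to_K, hf]
  -- The formula is forced: if α = Ad_U and f = U e, then α(|ξ⟩⟨e|) f = |Uξ⟩⟨Ue| f = Uξ.
  let V : H →ₗ[ℂ] H :=
    { toFun := fun ξ => (α (rankOneCompact ξ e) : H →L[ℂ] H) f
      map_add' := fun ξ η => by simp [rankOneCompact_add_left]
      map_smul' := fun c ξ => by simp [rankOneCompact_smul_left] }
  have hV : ∀ ξ, V ξ = (α (rankOneCompact ξ e) : H →L[ℂ] H) f := fun _ => rfl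
  have hVinner : ∀ ξ η, inner ℂ (V ξ) (V η) = (inner ℂ ξ η : ℂ) := fun ξ η => by
    have h1 : star (α (rankOneCompact ξ e)) * α (rankOneCompact η e) =
        inner ℂ ξ η • rankOneCompact f f := by
      rw [← map_star_compactOperators, ← map_mul, star_rankOneCompact,
        rankOneCompact_mul_rankOneCompact, map_smul, hef]
    have h2 := DFunLike.congr_fun (congr_arg Subtype.val h1) f
    have h3 : star (α (rankOneCompact ξ e) : H →L[ℂ] H) ((α (rankOneCompact η e) : H →L[ℂ] H) f)
        = (inner ℂ ξ η : ℂ) • f := by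
      refine Eq.trans h2 ?_
      simp [hf]
    rw [hV, hV, ← ContinuousLinearMap.adjoint_inner_right, ← ContinuousLinearMap.star_eq_adjoint,
      h3, inner_smul_right, hff, mul_one]
  have hVsurj : Surjective V := fun ζ => by
    -- This vector ξ satisfies |ξ⟩⟨e| = α⁻¹(|ζ⟩⟨f|) |e⟩⟨e|, which α maps to |ζ⟩⟨f|.
    refine ⟨(α.symm (rankOneCompact ζ f) : H →L[ℂ] H) e, ?_⟩
    rw [hV, ← mul_rankOneCompact, map_mul, hef, StarAlgEquiv.apply_symm_apply,
      rankOneCompact_mul_rankOneCompact, hff]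
    simp [hf]
  let W : H ≃ₗᵢ[ℂ] H := LinearIsometryEquiv.ofSurjective (V.isometryOfInner hVinner) hVsurj
  have hW : ∀ (A : compactOperators H) ξ, W ((A : H →L[ℂ] H) ξ) = (α A : H →L[ℂ] H) (W ξ) :=
    fun A ξ => by
      change V _ = (α A : H →L[ℂ] H) (V ξ)
      rw [hV, hV, ← mul_rankOneCompact, map_mul]
      rfl
  refine ⟨Unitary.linearIsometryEquiv.symm W, fun A => ?_⟩
  have h1 : (α A : H →L[ℂ] H) * (Unitary.linearIsometryEquiv.symm W : H →L[ℂ] H) =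
      (Unitary.linearIsometryEquiv.symm W : H →L[ℂ] H) * (A : H →L[ℂ] H) := by
    ext ξ
    exact (hW A ξ).symm
  rw [← h1, mul_assoc, Unitary.mul_star_self_of_mem (Subtype.prop _), mul_one]

end UnitaryImplementation

/-! ### Eigenvectors of a unitary and the compact operators commuting with it -/

section EigenSpan

variable {H : Type*} [NormedAddCommGroup H] [InnerProductSpace ℂ H]

/-- The span of all eigenvectors. -/
def eigenSpan (T : H →L[ℂ] H) : Submodule ℂ H :=
  ⨆ z, Module.End.eigenspace (T : Module.End ℂ H) z

theorem mem_orthogonal_eigenSpan {T : H →L[ℂ] H} {x : H} :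
    x ∈ (eigenSpan T)ᗮ ↔ ∀ (z : ℂ) (v : H), T v = z • v → inner ℂ v x = (0 : ℂ) := by
  rw [eigenSpan, ← Submodule.iInf_orthogonal, Submodule.mem_iInf]
  refine forall_congr' fun z => ?_
  rw [Submodule.mem_orthogonal]
  refine forall_congr' fun v => ?_
  rw [Module.End.mem_eigenspace_iff]
  rfl

end EigenSpan

section UnitaryEigenspaces

variable {H : Type*} [NormedAddCommGroup H] [InnerProductSpace ℂ H] [CompleteSpace H]

theorem Unitary.star_apply_apply (U : unitary (H →L[ℂ] H)) (x : H) :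
    star (U : H →L[ℂ] H) ((U : H →L[ℂ] H) x) = x :=
  DFunLike.congr_fun (Unitary.star_mul_self_of_mem U.2) x

theorem Unitary.apply_star_apply (U : unitary (H →L[ℂ] H)) (x : H) :
    (U : H →L[ℂ] H) (star (U : H →L[ℂ] H) x) = x :=
  DFunLike.congr_fun (Unitary.mul_star_self_of_mem U.2) x

theorem Unitary.inner_apply_left (U : unitary (H →L[ℂ] H)) (x y : H) :
    inner ℂ ((U : H →L[ℂ] H) x) y = (inner ℂ x (star (U : H →L[ℂ] H) y) : ℂ) := by
  rw [ContinuousLinearMap.star_eq_adjoint, ContinuousLinearMap.adjoint_inner_right]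

theorem Unitary.norm_apply (U : unitary (H →L[ℂ] H)) (x : H) : ‖(U : H →L[ℂ] H) x‖ = ‖x‖ := by
  have h : inner ℂ ((U : H →L[ℂ] H) x) ((U : H →L[ℂ] H) x) = (inner ℂ x x : ℂ) := by
    rw [Unitary.inner_apply_left, Unitary.star_apply_apply]
  rw [inner_self_eq_norm_sq_to_K, inner_self_eq_norm_sq_to_K] at h
  have h' : ‖(U : H →L[ℂ] H) x‖ ^ 2 = ‖x‖ ^ 2 := by exact_mod_cast h
  exact (sq_eq_sq₀ (norm_nonneg _) (norm_nonneg _)).1 h'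

/-- An operator which commutes with a unitary commutes with its adjoint. -/
theorem Unitary.commute_star {U : unitary (H →L[ℂ] H)} {S : H →L[ℂ] H}
    (h : Commute S (U : H →L[ℂ] H)) : Commute S (star (U : H →L[ℂ] H)) := by
  have h1 : star (U : H →L[ℂ] H) * U = 1 := Unitary.star_mul_self_of_mem U.2
  have h2 : (U : H →L[ℂ] H) * star (U : H →L[ℂ] H) = 1 := Unitary.mul_star_self_of_mem U.2
  change S * star (U : H →L[ℂ] H) = star (U : H →L[ℂ] H) * S
  calc S * star (U : H →L[ℂ] H) = star (U : H →L[ℂ] H) * (U * S) * star (U : H →L[ℂ] H) := by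
        rw [← mul_assoc, h1, one_mul]
    _ = star (U : H →L[ℂ] H) * S := by rw [← h.eq, mul_assoc, mul_assoc, h2, mul_one]

variable (U : unitary (H →L[ℂ] H))

theorem norm_eq_one_of_apply_eq_smul {z : ℂ} {x : H} (hx : x ≠ 0)
    (h : (U : H →L[ℂ] H) x = z • x) : ‖z‖ = 1 := by
  have := Unitary.norm_apply U x
  rw [h, norm_smul] at this
  exact mul_right_cancel₀ (norm_ne_zero_iff.2 hx) (this.trans (one_mul _).symm)

theorem star_apply_of_apply_eq_smul {z : ℂ} {x : H} (h : (U : H →L[ℂ] H) x = z • x) :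
    star (U : H →L[ℂ] H) x = star z • x := by
  by_cases hx : x = 0
  · simp [hx]
  have hz := norm_eq_one_of_apply_eq_smul U hx h
  have h1 := Unitary.star_apply_apply U x
  rw [h, map_smul] at h1
  have hzz : star z * z = 1 := by
    rw [RCLike.star_def, RCLike.conj_mul, hz]; simp
  rw [← one_smul ℂ (star (U : H →L[ℂ] H) x), ← hzz, mul_smul, h1]

theorem Unitary.apply_mem_orthogonal_eigenSpan {x : H} (hx : x ∈ (eigenSpan (U : H →L[ℂ] H))ᗮ) :
    (U : H →L[ℂ] H) x ∈ (eigenSpan (U : H →L[ℂ] H))ᗮ := by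
  rw [mem_orthogonal_eigenSpan] at hx ⊢
  intro z v hv
  rw [← inner_conj_symm, Unitary.inner_apply_left, star_apply_of_apply_eq_smul U hv,
    inner_smul_right, ← inner_conj_symm, hx z v hv]
  simp

/-- On the complement, a nonzero eigenvalue of R would have a finite-dimensional, U-invariant
eigenspace. It would contain an eigenvector of U orthogonal to all eigenvectors of U, which is
absurd. A compact symmetric operator with no nonzero eigenvalue is zero. -/
theorem apply_eq_zero_of_isSymmetric_of_commute {R : H →L[ℂ] H} (hR : IsCompactOperator R)
    (hRs : R.IsSymmetric) (hRU : Commute R (U : H →L[ℂ] H)) {x : H}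
    (hx : x ∈ (eigenSpan (U : H →L[ℂ] H))ᗮ) : R x = 0 := by
  have hRUx : ∀ y, R ((U : H →L[ℂ] H) y) = (U : H →L[ℂ] H) (R y) := DFunLike.congr_fun hRU.eq
  have hRK : ∀ y ∈ (eigenSpan (U : H →L[ℂ] H))ᗮ, R y ∈ (eigenSpan (U : H →L[ℂ] H))ᗮ :=
    fun y hy => by
      rw [mem_orthogonal_eigenSpan] at hy ⊢
      intro z v hv
      have h1 : inner ℂ (R v) y = (inner ℂ v (R y) : ℂ) := hRs v y
      rw [← h1]
      refine hy z _ ?_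
      rw [← hRUx, hv, map_smul]
  let R' : (eigenSpan (U : H →L[ℂ] H))ᗮ →L[ℂ] (eigenSpan (U : H →L[ℂ] H))ᗮ := R.restrict hRK
  have hR'c : IsCompactOperator R' := hR.restrict' (f := (R : H →ₗ[ℂ] H)) hRK
  have hR's : R'.IsSymmetric := hRs.restrict_invariant hRK
  have hR'0 : R' = 0 := by
    rw [← ContinuousLinearMap.eq_zero_of_forall_hasEigenvalue_eq_zero hR'c hR's]
    intro μ hμ
    by_contra hμ0
    have hfin := ContinuousLinearMap.finite_dimensional_eigenspace hR'c μ hμ0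
    let U' : (eigenSpan (U : H →L[ℂ] H))ᗮ →ₗ[ℂ] (eigenSpan (U : H →L[ℂ] H))ᗮ :=
      (U : H →L[ℂ] H).toLinearMap.restrict
        (fun y hy => Unitary.apply_mem_orthogonal_eigenSpan U hy)
    have hV : ∀ y ∈ Module.End.eigenspace R'.toLinearMap μ,
        U' y ∈ Module.End.eigenspace R'.toLinearMap μ := fun y hy => by
      rw [Module.End.mem_eigenspace_iff] at hy ⊢
      refine Subtype.ext ?_
      have hy' : R y = μ • (y : H) := congr_arg Subtype.val hy
      have h2 : R ((U : H →L[ℂ] H) y) = μ • (U : H →L[ℂ] H) y := by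
        rw [hRUx, hy', map_smul]
      exact h2
    have hVnt : Nontrivial (Module.End.eigenspace R'.toLinearMap μ) :=
      Submodule.nontrivial_iff_ne_bot.2 hμ
    obtain ⟨z, hz⟩ := Module.End.exists_eigenvalue (U'.restrict hV)
    obtain ⟨v, hv⟩ := hz.exists_hasEigenvector
    have hUv : (U : H →L[ℂ] H) ((v : (eigenSpan (U : H →L[ℂ] H))ᗮ) : H) =
        z • ((v : (eigenSpan (U : H →L[ℂ] H))ᗮ) : H) :=
      congr_arg Subtype.val (congr_arg Subtype.val hv.apply_eq_smul)
    have h0 := mem_orthogonal_eigenSpan.1 (v : (eigenSpan (U : H →L[ℂ] H))ᗮ).2 z _ hUv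
    exact hv.2 (Subtype.ext (Subtype.ext (inner_self_eq_zero.1 h0)))
  exact congr_arg Subtype.val (DFunLike.congr_fun hR'0 ⟨x, hx⟩)

/-- A compact operator which commutes with a unitary vanishes on the orthogonal complement of
the eigenvectors of the unitary. -/
theorem apply_eq_zero_of_commute {S : H →L[ℂ] H} (hS : IsCompactOperator S)
    (hSU : Commute S (U : H →L[ℂ] H)) {x : H} (hx : x ∈ (eigenSpan (U : H →L[ℂ] H))ᗮ) :
    S x = 0 := by
  -- Symmetry is gained by passing to S*S, which has the same kernel as S.
  have hRU : Commute (star S * S) (U : H →L[ℂ] H) := by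
    refine Commute.mul_left ?_ hSU
    have := (Unitary.commute_star hSU).star_star
    rwa [star_star] at this
  have hRx : (star S * S) x = 0 := by
    refine apply_eq_zero_of_isSymmetric_of_commute U (hS.clm_comp (star S)) (fun y w => ?_) hRU hx
    change inner ℂ (star S (S y)) w = (inner ℂ y (star S (S w)) : ℂ)
    rw [ContinuousLinearMap.star_eq_adjoint, ContinuousLinearMap.adjoint_inner_left,
      ContinuousLinearMap.adjoint_inner_right]
  have h1 : inner ℂ (S x) (S x) = (0 : ℂ) := by
    rw [← ContinuousLinearMap.adjoint_inner_right, ← ContinuousLinearMap.star_eq_adjoint]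
    change inner ℂ x ((star S * S) x) = _
    rw [hRx, inner_zero_right]
  exact inner_self_eq_zero.1 h1

end UnitaryEigenspaces

/-! ### Eigenprojections and block sums -/

section EigenProj

variable {H : Type*} [NormedAddCommGroup H] [InnerProductSpace ℂ H] [CompleteSpace H]

instance (U : H →L[ℂ] H) (z : ℂ) :
    CompleteSpace (Module.End.eigenspace (U : Module.End ℂ H) z) :=
  (ContinuousLinearMap.isClosed_eigenspace (f := U) (μ := z)).completeSpace_coe

theorem apply_eigenProj (U : H →L[ℂ] H) (z : ℂ) (x : H) :
    U (eigenProj U z x) = z • eigenProj U z x :=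
  Module.End.mem_eigenspace_iff.1 (Submodule.starProjection_apply_mem _ x)

theorem eigenProj_apply_of_apply_eq {U : H →L[ℂ] H} {z : ℂ} {x : H} (h : U x = z • x) :
    eigenProj U z x = x :=
  Submodule.starProjection_eq_self_iff.2 (Module.End.mem_eigenspace_iff.2 h)

theorem inner_eigenProj_left (U : H →L[ℂ] H) (z : ℂ) (x y : H) :
    inner ℂ (eigenProj U z x) y = (inner ℂ x (eigenProj U z y) : ℂ) :=
  Submodule.inner_starProjection_left_eq_right _ x y

variable (U : unitary (H →L[ℂ] H))

theorem inner_eq_zero_of_apply_eq_smul {z w : ℂ} (hzw : z ≠ w) {x y : H}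
    (hx : (U : H →L[ℂ] H) x = z • x) (hy : (U : H →L[ℂ] H) y = w • y) :
    inner ℂ x y = (0 : ℂ) := by
  by_cases hx0 : x = 0
  · simp [hx0]
  have hz := norm_eq_one_of_apply_eq_smul U hx0 hx
  have h1 := Unitary.inner_apply_left U x y
  rw [hx, star_apply_of_apply_eq_smul U hy, inner_smul_left, inner_smul_right] at h1
  have h2 : (starRingEnd ℂ z - starRingEnd ℂ w) * inner ℂ x y = 0 := by
    rw [sub_mul, h1, sub_eq_zero]; rfl
  refine (mul_eq_zero.1 h2).resolve_left fun h => hzw ?_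
  exact (starRingEnd ℂ).injective (sub_eq_zero.1 h)

theorem eigenProj_eq_zero_of_apply_eq_smul {z w : ℂ} (hzw : z ≠ w) {y : H}
    (hy : (U : H →L[ℂ] H) y = w • y) : eigenProj (U : H →L[ℂ] H) z y = 0 := by
  refine ext_inner_left ℂ fun v => ?_
  rw [← inner_eigenProj_left, inner_zero_right]
  exact inner_eq_zero_of_apply_eq_smul U hzw (apply_eigenProj _ z v) hy

theorem eigenProj_apply (z : ℂ) (x : H) : eigenProj (U : H →L[ℂ] H) z ((U : H →L[ℂ] H) x) =
    z • eigenProj (U : H →L[ℂ] H) z x := by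
  refine ext_inner_left ℂ fun v => ?_
  rw [← inner_eigenProj_left, ← inner_conj_symm, Unitary.inner_apply_left,
    star_apply_of_apply_eq_smul U (apply_eigenProj _ z v), inner_smul_right, inner_smul_right,
    map_mul, inner_conj_symm, inner_eigenProj_left, RCLike.star_def, RCLike.conj_conj]

theorem eigenProj_star_apply (z : ℂ) (x : H) :
    star (U : H →L[ℂ] H) (eigenProj (U : H →L[ℂ] H) z x) =
      star z • eigenProj (U : H →L[ℂ] H) z x :=
  star_apply_of_apply_eq_smul U (apply_eigenProj _ z x)

theorem orthogonalFamily_eigenspace :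
    OrthogonalFamily ℂ (fun z : ppSpectrum (U : H →L[ℂ] H) =>
        Module.End.eigenspace ((U : H →L[ℂ] H) : Module.End ℂ H) (z : ℂ))
      fun z => (Module.End.eigenspace ((U : H →L[ℂ] H) : Module.End ℂ H) (z : ℂ)).subtypeₗᵢ :=
  fun _ _ hzw x y => inner_eq_zero_of_apply_eq_smul U (fun h => hzw (Subtype.ext h))
    (Module.End.mem_eigenspace_iff.1 x.2) (Module.End.mem_eigenspace_iff.1 y.2)

theorem sum_norm_sq_eigenProj_le (s : Finset (ppSpectrum (U : H →L[ℂ] H))) (x : H) :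
    ∑ z ∈ s, ‖eigenProj (U : H →L[ℂ] H) z x‖ ^ 2 ≤ ‖x‖ ^ 2 := by
  have h1 := (orthogonalFamily_eigenspace U).norm_sum
    (fun z => ⟨eigenProj (U : H →L[ℂ] H) z x, Submodule.starProjection_apply_mem _ x⟩) s
  set p := ∑ z ∈ s, eigenProj (U : H →L[ℂ] H) z x
  change ‖p‖ ^ 2 = ∑ z ∈ s, ‖eigenProj (U : H →L[ℂ] H) z x‖ ^ 2 at h1
  have h2 : inner ℂ x p = ((∑ z ∈ s, ‖eigenProj (U : H →L[ℂ] H) z x‖ ^ 2 : ℝ) : ℂ) := by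
    rw [inner_sum]
    push_cast
    refine Finset.sum_congr rfl fun z _ => ?_
    rw [← eigenProj_apply_of_apply_eq (apply_eigenProj (U : H →L[ℂ] H) z x),
      ← inner_eigenProj_left, eigenProj_apply_of_apply_eq (apply_eigenProj (U : H →L[ℂ] H) z x),
      inner_self_eq_norm_sq_to_K]
    rfl
  have h3 := norm_inner_le_norm (𝕜 := ℂ) x p
  rw [h2, Complex.norm_of_nonneg (Finset.sum_nonneg fun _ _ => by positivity), ← h1] at h3
  rw [← h1]
  -- Cauchy–Schwarz has given ‖p‖² ≤ ‖x‖ ‖p‖.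
  nlinarith [norm_nonneg p, norm_nonneg x, sq_nonneg (‖p‖ - ‖x‖)]

/-- The sum of the eigenprojections converges strongly to the projection onto the closed span of
the eigenvectors. -/
theorem exists_hasSum_eigenProj (x : H) :
    ∃ y, HasSum (fun z : ppSpectrum (U : H →L[ℂ] H) => eigenProj (U : H →L[ℂ] H) z x) y ∧
      x - y ∈ (eigenSpan (U : H →L[ℂ] H))ᗮ := by
  have hs : Summable (fun z : ppSpectrum (U : H →L[ℂ] H) => eigenProj (U : H →L[ℂ] H) z x) :=
    ((orthogonalFamily_eigenspace U).summable_iff_norm_sq_summable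
      (fun z => ⟨eigenProj (U : H →L[ℂ] H) z x, Submodule.starProjection_apply_mem _ x⟩)).2
      (summable_of_sum_le (fun _ => by positivity) (sum_norm_sq_eigenProj_le U · x))
  obtain ⟨y, hy⟩ := hs
  refine ⟨y, hy, mem_orthogonal_eigenSpan.2 fun w v hv => ?_⟩
  by_cases hv0 : v = 0
  · simp [hv0]
  have hw : w ∈ ppSpectrum (U : H →L[ℂ] H) :=
    ⟨norm_eq_one_of_apply_eq_smul U hv0 hv,
      Module.End.hasEigenvalue_of_hasEigenvector ⟨Module.End.mem_eigenspace_iff.2 hv, hv0⟩⟩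
  have h1 : HasSum (fun z : ppSpectrum (U : H →L[ℂ] H) =>
      (inner ℂ v (eigenProj (U : H →L[ℂ] H) z x) : ℂ)) (inner ℂ v y) :=
    hy.mapL (innerSL ℂ v)
  -- Orthogonality of eigenspaces leaves only the term z = w, equal to ⟨v, x⟩.
  have h2 := hasSum_single (f := fun z : ppSpectrum (U : H →L[ℂ] H) =>
      (inner ℂ v (eigenProj (U : H →L[ℂ] H) z x) : ℂ)) ⟨w, hw⟩ fun z hz => by
    rw [← inner_eigenProj_left,
      eigenProj_eq_zero_of_apply_eq_smul U (fun h => hz (Subtype.ext h)) hv, inner_zero_left]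
  have h3 := h1.unique h2
  rw [inner_sub_right, h3, ← inner_eigenProj_left, eigenProj_apply_of_apply_eq hv, sub_self]

/-- A compact operator commuting with `U` is the sum of its diagonal blocks. -/
theorem hasSum_eigenProj_of_commute {S : H →L[ℂ] H} (hS : IsCompactOperator S)
    (hSU : Commute S (U : H →L[ℂ] H)) (x : H) :
    HasSum (fun z : ppSpectrum (U : H →L[ℂ] H) =>
      eigenProj (U : H →L[ℂ] H) z (S (eigenProj (U : H →L[ℂ] H) z x))) (S x) := by
  obtain ⟨y, hy, hxy⟩ := exists_hasSum_eigenProj U x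
  have h0 := apply_eq_zero_of_commute U hS hSU hxy
  rw [map_sub, sub_eq_zero] at h0
  rw [h0]
  -- S preserves the eigenspaces of U, so E_z S E_z = S E_z.
  convert hy.mapL S using 2 with z
  refine eigenProj_apply_of_apply_eq ?_
  have h1 : (U : H →L[ℂ] H) (S (eigenProj (U : H →L[ℂ] H) z x)) =
    S ((U : H →L[ℂ] H) (eigenProj (U : H →L[ℂ] H) z x)) := DFunLike.congr_fun hSU.eq.symm _
  rw [h1, apply_eigenProj, map_smul]

/-- Members of `⨁_z E_z B(H) E_z` commute with `U`. -/
theorem commute_of_mem_eigenBlockSum {B : H →L[ℂ] H}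
    (hB : B ∈ eigenBlockSum (U : H →L[ℂ] H)) : Commute B (U : H →L[ℂ] H) := by
  obtain ⟨C, -, hC⟩ := hB
  refine ContinuousLinearMap.ext fun x => ?_
  change B ((U : H →L[ℂ] H) x) = (U : H →L[ℂ] H) (B x)
  refine (hC ((U : H →L[ℂ] H) x)).unique ?_
  convert (hC x).mapL (U : H →L[ℂ] H) using 2 with z
  rw [apply_eigenProj, eigenProj_apply, map_smul, map_smul]

/-- For the converse the constant family C_z = B serves. -/
theorem mem_eigenBlockSum_iff_commute {B : H →L[ℂ] H} (hB : IsCompactOperator B) :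
    B ∈ eigenBlockSum (U : H →L[ℂ] H) ↔ Commute B (U : H →L[ℂ] H) :=
  ⟨commute_of_mem_eigenBlockSum U, fun h =>
    ⟨fun _ => B, ⟨‖B‖, fun _ => le_rfl⟩, hasSum_eigenProj_of_commute U hB h⟩⟩

end EigenProj

/-! ### Hilbert–Schmidt operators -/

section HilbertSchmidt

variable {H : Type*} [NormedAddCommGroup H] [InnerProductSpace ℂ H]

theorem sum_rankOne_apply {ι : Type*} (T : H →L[ℂ] H) (b : ι → H) (s : Finset ι) (x : H) :
    (∑ i ∈ s, rankOne ℂ (T (b i)) (b i)) x = ∑ i ∈ s, (inner ℂ (b i) x : ℂ) • T (b i) := by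
  simp

/-- The sum is T composed with the projection onto the span of the b i, i ∈ s; Bessel's inequality
bounds the latter. -/
theorem norm_sum_rankOne_le_norm {ι : Type*} {b : ι → H} (hb : Orthonormal ℂ b) (T : H →L[ℂ] H)
    (s : Finset ι) : ‖∑ i ∈ s, rankOne ℂ (T (b i)) (b i)‖ ≤ ‖T‖ := by
  refine ContinuousLinearMap.opNorm_le_bound _ (norm_nonneg _) fun x => ?_
  have h1 : ∑ i ∈ s, (inner ℂ (b i) x : ℂ) • T (b i) =
      T (∑ i ∈ s, (inner ℂ (b i) x : ℂ) • b i) := by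
    simp
  rw [sum_rankOne_apply, h1]
  refine T.le_opNorm_of_le ?_
  refine (sq_le_sq₀ (norm_nonneg _) (norm_nonneg x)).1 ?_
  have h2 : ‖∑ i ∈ s, (inner ℂ (b i) x : ℂ) • b i‖ ^ 2 = ∑ i ∈ s, ‖(inner ℂ (b i) x : ℂ)‖ ^ 2 := by
    have h3 := hb.inner_sum (fun i => (inner ℂ (b i) x : ℂ)) (fun i => (inner ℂ (b i) x : ℂ)) s
    rw [inner_self_eq_norm_sq_to_K] at h3
    have h4 : ((‖∑ i ∈ s, (inner ℂ (b i) x : ℂ) • b i‖ ^ 2 : ℝ) : ℂ) =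
        ((∑ i ∈ s, ‖(inner ℂ (b i) x : ℂ)‖ ^ 2 : ℝ) : ℂ) := by
      push_cast
      refine h3.trans (Finset.sum_congr rfl fun i _ => ?_)
      exact RCLike.conj_mul _
    exact_mod_cast h4
  rw [h2]
  exact hb.sum_inner_products_le x

/-- The Hilbert–Schmidt norm dominates the operator norm, by Cauchy–Schwarz and Bessel. -/
theorem norm_sq_sum_rankOne_le {ι : Type*} {b : ι → H} (hb : Orthonormal ℂ b) (T : H →L[ℂ] H)
    (s : Finset ι) :
    ‖∑ i ∈ s, rankOne ℂ (T (b i)) (b i)‖ ^ 2 ≤ ∑ i ∈ s, ‖T (b i)‖ ^ 2 := by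
  have hn : 0 ≤ ∑ i ∈ s, ‖T (b i)‖ ^ 2 := Finset.sum_nonneg fun _ _ => by positivity
  rw [← Real.le_sqrt (norm_nonneg _) hn]
  refine ContinuousLinearMap.opNorm_le_bound _ (Real.sqrt_nonneg _) fun x => ?_
  rw [sum_rankOne_apply]
  refine (sq_le_sq₀ (norm_nonneg _) (by positivity)).1 ?_
  rw [mul_pow, Real.sq_sqrt hn]
  calc ‖∑ i ∈ s, (inner ℂ (b i) x : ℂ) • T (b i)‖ ^ 2
      ≤ (∑ i ∈ s, ‖T (b i)‖ * ‖(inner ℂ (b i) x : ℂ)‖) ^ 2 := by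
        gcongr
        refine norm_sum_le_of_le _ fun i _ => ?_
        rw [norm_smul, mul_comm]
    _ ≤ (∑ i ∈ s, ‖T (b i)‖ ^ 2) * ∑ i ∈ s, ‖(inner ℂ (b i) x : ℂ)‖ ^ 2 :=
        Finset.sum_mul_sq_le_sq_mul_sq _ _ _
    _ ≤ (∑ i ∈ s, ‖T (b i)‖ ^ 2) * ‖x‖ ^ 2 := by
        gcongr
        exact hb.sum_inner_products_le x

variable [CompleteSpace H]

/-- Hilbert–Schmidt operators are compact. -/
theorem isCompactOperator_of_sum_norm_sq_le {ι : Type*} (b : HilbertBasis ι ℂ H) (T : H →L[ℂ] H)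
    {c : ℝ} (h : ∀ s : Finset ι, ∑ i ∈ s, ‖T (b i)‖ ^ 2 ≤ c) : IsCompactOperator T := by
  have hs : Summable fun i => ‖T (b i)‖ ^ 2 := summable_of_sum_le (fun _ => by positivity) h
  -- Tails of the expansion are small in operator norm, so T is a norm limit of finite rank
  -- operators.
  have hsum : Summable fun i => rankOne ℂ (T (b i)) (b i) := by
    rw [summable_iff_vanishing_norm]
    intro ε hε
    obtain ⟨s, hs⟩ := summable_iff_vanishing_norm.1 hs (ε ^ 2) (by positivity)
    refine ⟨s, fun t ht => lt_of_pow_lt_pow_left₀ 2 hε.le ?_⟩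
    exact (norm_sq_sum_rankOne_le b.orthonormal T t).trans_lt ((le_abs_self _).trans_lt (hs t ht))
  obtain ⟨R, hR⟩ := hsum
  have hRT : R = T := by
    ext x
    have h1 : HasSum (fun i => rankOne ℂ (T (b i)) (b i) x) (R x) :=
      hR.mapL (ContinuousLinearMap.apply ℂ H x)
    have h2 := (b.hasSum_repr x).mapL T
    refine h1.unique ?_
    convert h2 using 2 with i
    simp [b.repr_apply_apply]
  rw [← hRT]
  refine isCompactOperator_of_tendsto (l := atTop) hR (Eventually.of_forall fun s => ?_)
  have h3 : ∑ i ∈ s, rankOne ℂ (T (b i)) (b i) ∈ compactOperators H :=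
    sum_mem fun i _ => isCompactOperator_rankOne (T (b i)) (b i)
  exact h3

end HilbertSchmidt

/-! ### Bounded functionals on K(H) and their invariance -/

section Functional

variable {H : Type*} [NormedAddCommGroup H] [InnerProductSpace ℂ H] [CompleteSpace H]

/-- A bounded functional on `K(H)` is given on the rank one operators by a bounded operator. -/
theorem exists_inner_eq_apply_rankOneCompact (φ : StrongDual ℂ (compactOperators H)) :
    ∃ T : H →L[ℂ] H, ∀ x y, inner ℂ (T y) x = φ (rankOneCompact x y) := by
  let B : H →L⋆[ℂ] H →L[ℂ] ℂ := LinearMap.mkContinuous₂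
    (LinearMap.mk₂'ₛₗ (starRingEnd ℂ) (RingHom.id ℂ) (fun y x => φ (rankOneCompact x y))
      (fun y y' x => by rw [rankOneCompact_add_right, map_add])
      (fun c y x => by rw [rankOneCompact_smul_right, map_smul]; rfl)
      (fun y x x' => by rw [rankOneCompact_add_left, map_add])
      (fun c y x => by rw [rankOneCompact_smul_left, map_smul]; rfl)) ‖φ‖ fun y x => by
        refine (φ.le_opNorm _).trans_eq ?_
        rw [norm_rankOneCompact]
        ring
  exact ⟨continuousLinearMapOfBilin B, fun x y => continuousLinearMapOfBilin_apply B y x⟩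

/-- The operator which represents a bounded functional on `K(H)` is compact. -/
theorem isCompactOperator_of_inner_eq {φ : StrongDual ℂ (compactOperators H)} {T : H →L[ℂ] H}
    (hT : ∀ x y, inner ℂ (T y) x = φ (rankOneCompact x y)) : IsCompactOperator T := by
  obtain ⟨w, b, -⟩ := exists_hilbertBasis ℂ H
  -- ∑ ‖T (b i)‖² is the value of φ at ∑ |T (b i)⟩⟨b i|, an operator of norm at most ‖T‖.
  refine isCompactOperator_of_sum_norm_sq_le b T (c := ‖φ‖ * ‖T‖) fun s => ?_
  have h1 : ((∑ i ∈ s, ‖T (b i)‖ ^ 2 : ℝ) : ℂ) =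
      φ (∑ i ∈ s, rankOneCompact (T (b i)) (b i)) := by
    rw [map_sum]
    push_cast
    refine Finset.sum_congr rfl fun i _ => ?_
    rw [← hT, inner_self_eq_norm_sq_to_K]
    rfl
  have h2 : ‖∑ i ∈ s, rankOneCompact (T (b i)) (b i)‖ ≤ ‖T‖ := by
    refine le_of_eq_of_le ?_ (norm_sum_rankOne_le_norm b.orthonormal T s)
    change ‖((∑ i ∈ s, rankOneCompact (T (b i)) (b i) : compactOperators H) : H →L[ℂ] H)‖ = _
    simp
  have h3 := φ.le_opNorm_of_le h2
  rwa [← h1, Complex.norm_of_nonneg (Finset.sum_nonneg fun _ _ => by positivity)] at h3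

variable {U : unitary (H →L[ℂ] H)} {α : compactOperators H ≃⋆ₐ[ℂ] compactOperators H}

theorem Implements.map_rankOneCompact (h : Implements U α) (x y : H) :
    α (rankOneCompact x y) = rankOneCompact ((U : H →L[ℂ] H) x) ((U : H →L[ℂ] H) y) := by
  refine Subtype.ext ?_
  rw [h]
  ext v
  simp [Unitary.inner_apply_left]

theorem Implements.norm_map (h : Implements U α) (A : compactOperators H) : ‖α A‖ = ‖A‖ := by
  change ‖(α A : H →L[ℂ] H)‖ = ‖(A : H →L[ℂ] H)‖
  rw [h, ← Unitary.coe_star, CStarRing.norm_mul_coe_unitary, CStarRing.norm_coe_unitary_mul]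

theorem Implements.map_eq_iff_commute (h : Implements U α) (A : compactOperators H) :
    α A = A ↔ Commute (A : H →L[ℂ] H) (U : H →L[ℂ] H) := by
  rw [Subtype.ext_iff, h]
  constructor
  · intro hA
    change _ = _
    conv_lhs => rw [← hA]
    rw [mul_assoc, Unitary.star_mul_self_of_mem U.2, mul_one]
  · intro hA
    rw [← hA.eq, mul_assoc, Unitary.mul_star_self_of_mem U.2, mul_one]

/-- U contributes the factor z on the left and U* the factor conj z on the right; |z| = 1 cancels
them. -/
theorem Implements.eigenProj_map (h : Implements U α) (A : compactOperators H)
    (z : ppSpectrum (U : H →L[ℂ] H)) (x : H) :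
    eigenProj (U : H →L[ℂ] H) z ((α A : H →L[ℂ] H) (eigenProj (U : H →L[ℂ] H) z x)) =
      eigenProj (U : H →L[ℂ] H) z ((A : H →L[ℂ] H) (eigenProj (U : H →L[ℂ] H) z x)) := by
  have hz : star (z : ℂ) * z = 1 := by
    rw [RCLike.star_def, RCLike.conj_mul, z.2.1]; simp
  rw [h]
  change eigenProj (U : H →L[ℂ] H) z ((U : H →L[ℂ] H) ((A : H →L[ℂ] H)
    (star (U : H →L[ℂ] H) (eigenProj (U : H →L[ℂ] H) z x)))) = _
  rw [eigenProj_apply, eigenProj_star_apply, map_smul, map_smul, smul_smul, mul_comm, hz, one_smul]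

/-- An `α`-invariant bounded functional on `K(H)` is determined by its values on the fixed points
of `α`. -/
theorem Implements.eq_zero_of_invariant (h : Implements U α)
    (φ : StrongDual ℂ (compactOperators H)) (hinv : ∀ A, φ (α A) = φ A)
    (hfix : ∀ A, α A = A → φ A = 0) : φ = 0 := by
  obtain ⟨T, hT⟩ := exists_inner_eq_apply_rankOneCompact φ
  have hTU : Commute T (U : H →L[ℂ] H) := by
    refine ContinuousLinearMap.ext fun y => ext_inner_right ℂ fun x => ?_
    change inner ℂ (T ((U : H →L[ℂ] H) y)) x = inner ℂ ((U : H →L[ℂ] H) (T y)) x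
    rw [Unitary.inner_apply_left, hT, hT,
      ← hinv (rankOneCompact (star (U : H →L[ℂ] H) x) y), h.map_rankOneCompact,
      Unitary.apply_star_apply]
  have hT0 : T = 0 := by
    ext y
    refine (hasSum_eigenProj_of_commute U (isCompactOperator_of_inner_eq hT) hTU y).unique ?_
    rw [zero_apply]
    convert hasSum_zero using 2 with z
    refine ext_inner_right ℂ fun x => ?_
    rw [inner_eigenProj_left, hT, inner_zero_left]
    -- A matrix entry of E_z T E_z is φ(|E_z x⟩⟨E_z y|), and U multiplies both vectors by z, so this
    -- operator is fixed.
    refine hfix _ ?_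
    have hz : (z : ℂ) * star (z : ℂ) = 1 := by
      rw [RCLike.star_def, RCLike.mul_conj, z.2.1]; simp
    rw [h.map_rankOneCompact, apply_eigenProj, apply_eigenProj, rankOneCompact_smul_left,
      rankOneCompact_smul_right, smul_smul, hz, one_smul]
  refine eq_zero_of_forall_rankOneCompact φ fun x y => ?_
  rw [← hT, hT0]
  simp

end Functional

/-! ### The limit as a conditional expectation -/

section ConditionalExpectation

variable {X : Type*} [NormedAddCommGroup X] [NormedSpace ℂ X]

/-- Limits of Birkhoff averages commute with the continuous linear maps which commute with the
dynamics. -/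
theorem map_limit_birkhoffAverage {f E L : X →ₗ[ℂ] X} (hL : Continuous L)
    (hE : ∀ x, Tendsto (birkhoffAverage ℂ f id · x) atTop (𝓝 (E x)))
    (hfL : ∀ x, f (L x) = L (f x)) (x : X) : E (L x) = L (E x) := by
  refine tendsto_nhds_unique (hE (L x)) (((hL.tendsto _).comp (hE x)).congr fun n => ?_)
  have h1 : ∀ k x, f^[k] (L x) = L (f^[k] x) := fun k =>
    (Semiconj.iterate_right (fun x => (hfL x).symm) k · |>.symm)
  rw [comp_apply, map_birkhoffAverage ℂ ℂ L]
  simp [birkhoffAverage, birkhoffSum, h1]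

/-- A continuous linear map invariant under the dynamics does not see the averaging. -/
theorem map_limit_birkhoffAverage_of_invariant {Y : Type*} [NormedAddCommGroup Y] [NormedSpace ℂ Y]
    {f : X → X} {E : X → X} (L : X →L[ℂ] Y)
    (hE : ∀ x, Tendsto (birkhoffAverage ℂ f id · x) atTop (𝓝 (E x)))
    (hfL : ∀ x, L (f x) = L x) (x : X) : L (E x) = L x := by
  refine tendsto_nhds_unique ((L.continuous.tendsto _).comp (hE x))
    -- The average of length 0 is 0, not x, so n = 0 is excluded.
    (tendsto_const_nhds.congr' ((eventually_ne_atTop 0).mono fun n hn => ?_))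
  rw [comp_apply, map_birkhoffAverage ℂ ℂ L]
  exact (congr_fun (birkhoffAverage_of_comp_eq (f := f) (g := L) ℂ (funext hfL)
    (Nat.cast_ne_zero.2 hn)) x).symm

variable {H : Type*} [NormedAddCommGroup H] [InnerProductSpace ℂ H] [CompleteSpace H]

instance : CompleteSpace (compactOperators H) := by
  have h : IsClosed {T : H →L[ℂ] H | IsCompactOperator T} := isClosed_setOfPred_isCompactOperator
  exact h.completeSpace_coe

/-- The fixed points of an automorphism of `K(H)`. -/
noncomputable def fixedPointSubalgebra (α : compactOperators H ≃⋆ₐ[ℂ] compactOperators H) :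
    NonUnitalStarSubalgebra ℂ (compactOperators H) where
  carrier := {A | α A = A}
  add_mem' {A B} hA hB := by
    change α (A + B) = A + B
    rw [map_add, show α A = A from hA, show α B = B from hB]
  zero_mem' := map_zero α
  mul_mem' {A B} hA hB := by
    change α (A * B) = A * B
    rw [map_mul, show α A = A from hA, show α B = B from hB]
  smul_mem' c A hA := by
    change α (c • A) = c • A
    rw [map_smul, show α A = A from hA]
  star_mem' {A} hA := by
    change α (star A) = star A
    rw [map_star_compactOperators, show α A = A from hA]

/-- An automorphism of `K(H)` as a linear map. -/
noncomputable def automorphismLinearMap (α : compactOperators H ≃⋆ₐ[ℂ] compactOperators H) :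
    compactOperators H →ₗ[ℂ] compactOperators H where
  toFun := α
  map_add' := map_add α
  map_smul' := map_smul α

variable {U : unitary (H →L[ℂ] H)} {α : compactOperators H ≃⋆ₐ[ℂ] compactOperators H}

theorem Implements.lipschitzWith (h : Implements U α) :
    LipschitzWith 1 (automorphismLinearMap α) :=
  (AddMonoidHomClass.isometry_of_norm (automorphismLinearMap α) h.norm_map).lipschitz

theorem birkhoffAverage_automorphismLinearMap (α : compactOperators H ≃⋆ₐ[ℂ] compactOperators H)
    (N : ℕ) (A : compactOperators H) :
    birkhoffAverage ℂ (automorphismLinearMap α) id N A =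
      (N : ℂ)⁻¹ • ∑ n ∈ Finset.range N, (α ^ n) A := by
  have h : ∀ n, (automorphismLinearMap α)^[n] A = (α ^ n) A := fun n => by
    induction n with
    | zero => rfl
    | succ k ih =>
      rw [iterate_succ_apply', ih, pow_succ']
      rfl
  simp only [birkhoffAverage, birkhoffSum, id, h]

open ComplexOrder in
/-- Block sums of positive operators are positive. -/
theorem isPositive_of_hasSum_eigenProj {V A B : H →L[ℂ] H} (hA : A.IsPositive)
    (hB : ∀ x, HasSum (fun z : ppSpectrum V => eigenProj V z (A (eigenProj V z x))) (B x)) :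
    B.IsPositive := by
  have h : ∀ x, (0 : ℂ) ≤ inner ℂ x (B x) := fun x => by
    refine ((hB x).mapL (innerSL ℂ x)).nonneg fun z => ?_
    rw [innerSL_apply_apply, ← inner_eigenProj_left]
    exact hA.inner_nonneg_right _
  rw [ContinuousLinearMap.isPositive_iff_complex]
  intro x
  have h1 := Complex.nonneg_iff.1 (h x)
  have h2 : inner ℂ (B x) x = (inner ℂ x (B x) : ℂ) := by
    rw [← inner_conj_symm, Complex.conj_eq_iff_im]
    exact h1.2.symm
  rw [h2]
  exact ⟨Complex.ext rfl h1.2, h1.1⟩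

/-- The limit of the Cesàro means of `α` is a conditional expectation onto the fixed points. -/
theorem Implements.isConditionalExpectation (h : Implements U α)
    {E : compactOperators H →ₗ[ℂ] compactOperators H}
    (hE : ∀ A, Tendsto (birkhoffAverage ℂ (automorphismLinearMap α) id · A) atTop (𝓝 (E A)))
    (hsum : ∀ (A : compactOperators H) (x : H),
      HasSum (fun z : ppSpectrum (U : H →L[ℂ] H) =>
        eigenProj (U : H →L[ℂ] H) z ((A : H →L[ℂ] H) (eigenProj (U : H →L[ℂ] H) z x)))
        ((E A : H →L[ℂ] H) x)) :
    IsConditionalExpectation (fixedPointSubalgebra α) E where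
  isClosed := isClosed_eq h.lipschitzWith.continuous continuous_id
  map_mem A := map_eq_of_tendsto_birkhoffAverage h.lipschitzWith (hE A)
  map_of_mem B hB := tendsto_nhds_unique (hE B)
    (IsFixedPt.tendsto_birkhoffAverage ℂ (f := automorphismLinearMap α) hB id)
  norm_map_le A := le_of_tendsto (hE A).norm
    (Eventually.of_forall fun n => norm_birkhoffAverage_id_le h.lipschitzWith n A)
  map_isPositive A hA := isPositive_of_hasSum_eigenProj hA (hsum A)
  map_mul_left B hB A := by
    refine map_limit_birkhoffAverage (L := LinearMap.mulLeft ℂ B) (continuous_const_mul B) hE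
      (fun A => ?_) A
    change α (B * A) = B * α A
    rw [map_mul, show α B = B from hB]
  map_mul_right B hB A := by
    refine map_limit_birkhoffAverage (L := LinearMap.mulRight ℂ B) (continuous_mul_const B) hE
      (fun A => ?_) A
    change α (A * B) = α A * B
    rw [map_mul, show α B = B from hB]

/-- The limit of the Cesàro means of `α` at `A` is the strong sum of the diagonal blocks of `A`. -/
theorem Implements.hasSum_limit (h : Implements U α)
    {E : compactOperators H →ₗ[ℂ] compactOperators H}
    (hE : ∀ A, Tendsto (birkhoffAverage ℂ (automorphismLinearMap α) id · A) atTop (𝓝 (E A)))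
    (A : compactOperators H) (x : H) :
    HasSum (fun z : ppSpectrum (U : H →L[ℂ] H) =>
      eigenProj (U : H →L[ℂ] H) z ((A : H →L[ℂ] H) (eigenProj (U : H →L[ℂ] H) z x)))
      ((E A : H →L[ℂ] H) x) := by
  have hcomm := (h.map_eq_iff_commute (E A)).1
    (map_eq_of_tendsto_birkhoffAverage h.lipschitzWith (hE A))
  -- E(A) is the sum of its own blocks; it remains to see that they agree with those of A, through
  -- the invariant map L(A) = E_z A E_z x.
  convert hasSum_eigenProj_of_commute U (E A).2 hcomm x using 2 with z
  let ev : compactOperators H →ₗ[ℂ] H :=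
    { toFun := fun A => (A : H →L[ℂ] H) (eigenProj (U : H →L[ℂ] H) z x)
      map_add' := fun _ _ => rfl
      map_smul' := fun _ _ => rfl }
  let L : compactOperators H →L[ℂ] H := eigenProj (U : H →L[ℂ] H) z ∘L
    ev.mkContinuous ‖eigenProj (U : H →L[ℂ] H) z x‖ fun A =>
      ((A : H →L[ℂ] H).le_opNorm _).trans_eq (mul_comm _ _)
  exact (map_limit_birkhoffAverage_of_invariant L hE (fun B => h.eigenProj_map B z x) A).symm

end ConditionalExpectation

theorem theorem4p5 {H : Type*} [NormedAddCommGroup H] [InnerProductSpace ℂ H] [CompleteSpace H]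
    (α : compactOperators H ≃⋆ₐ[ℂ] compactOperators H) :
    (∃ U : unitary (H →L[ℂ] H), Implements U α) ∧
    ∀ U : unitary (H →L[ℂ] H), Implements U α →
      ∃ (E : compactOperators H →ₗ[ℂ] compactOperators H)
        (𝔅 : NonUnitalStarSubalgebra ℂ (compactOperators H)),
        -- `E(A) = ∑_z E_z A E_z`, in the strong operator topology
        (∀ (A : compactOperators H) (x : H),
          HasSum (fun z : ppSpectrum (U : H →L[ℂ] H) =>
            eigenProj (U : H →L[ℂ] H) z ((A : H →L[ℂ] H) (eigenProj (U : H →L[ℂ] H) z x)))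
            ((E A : H →L[ℂ] H) x)) ∧
        -- `E` is a conditional expectation onto `(⨁_z E_z B(H) E_z) ∩ K(H)`
        (∀ A : compactOperators H,
          A ∈ 𝔅 ↔ (A : H →L[ℂ] H) ∈ eigenBlockSum (U : H →L[ℂ] H)) ∧
        IsConditionalExpectation 𝔅 E ∧
        -- the Cesàro means converge pointwise to `E` in the weak topology of `K(H)`
        ∀ A : compactOperators H,
          Tendsto (fun N : ℕ => toWeakSpace ℂ (compactOperators H)
              ((N : ℂ)⁻¹ • ∑ n ∈ Finset.range N, (α ^ n) A))
            atTop (𝓝 (toWeakSpace ℂ (compactOperators H) (E A))) := by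
  refine ⟨exists_implements α, fun U h => ?_⟩
  obtain ⟨E, hE⟩ := exists_tendsto_birkhoffAverage h.lipschitzWith h.eq_zero_of_invariant
  refine ⟨E, fixedPointSubalgebra α, h.hasSum_limit hE, fun A => ?_,
    h.isConditionalExpectation hE (h.hasSum_limit hE), fun A => ?_⟩
  · exact (h.map_eq_iff_commute A).trans (mem_eigenBlockSum_iff_commute U A.2).symm
  · refine (((toWeakSpaceCLM ℂ (compactOperators H)).continuous.tendsto _).comp (hE A)).congr
      fun N => ?_
    rw [comp_apply, birkhoffAverage_automorphismLinearMap, toWeakSpaceCLM_eq_toWeakSpace]
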